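/- Let $\nu>-1$ and let $J_\nu(x)=\sum_{n\ge 0}\frac{(-1)^n (x/2)^{2n+\nu}}{n!\,\Gamma(n+\nu+1)}$ $(x>0)$ be the Bessel function of the first kind of order $\nu$. Put $$d_\nu(x)=(1-\nu)J_\nu(x)+xJ_\nu'(x),\qquad g_\nu(x)=2^\nu\Gamma(\nu+1)x^{1-\nu}J_\nu(x)\qquad(x>0),$$ let $\alpha_{\nu,0}=0$, let $\alpha_{\nu,n}$ $(n\ge1)$ be the $n$th positive zero of the Dini function $d_\nu$, and let $\Delta_\nu=\bigcup_{k\ge0}(\alpha_{\nu,2k},\alpha_{\nu,2k+1})$. Then $g_\nu$ is differentiable on $(0,\infty)$ with $g_\nu'(x)=2^\nu\Gamma(\nu+1)x^{-\nu}d_\nu(x)$, and $g_\nu'$ is positive and log-concave on each of the intervals $(\alpha_{\nu,2k},\alpha_{\nu,2k+1})$ that make up $\Delta_\nu$. Consequently, for all $a,b$ lying in the same interval $(\alpha_{\nu,2k},\alpha_{\nu,2k+1})$ of $\Delta_\nu$, $k\ge0$, $$|g_\nu(a)-g_\nu(b)|\ \ge\ |a-b|\sqrt{g_\nu'(a)\,g_\nu'(b)},$$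 or equivalently $$\left|a^{1-\nu}J_\nu(a)-b^{1-\nu}J_\nu(b)\right|\ \ge\ |a-b|\sqrt{(ab)^{-\nu}d_\nu(a)d_\nu(b)}.$$ -/

import Mathlib

noncomputable section

/-- The Bessel function of the first kind `J_ν`, real order, on the positive half-line:
`J_ν(x) = ∑_{n ≥ 0} (-1)^n (x/2)^(2n+ν) / (n! Γ(n+ν+1))`. -/
def besselJ (ν x : ℝ) : ℝ :=
  ∑' n : ℕ, (-1 : ℝ) ^ n * (x / 2) ^ (2 * (n : ℝ) + ν) /
    ((n.factorial : ℝ) * Real.Gamma ((n : ℝ) + ν + 1))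

/-- The Dini function `d_ν(x) = (1 - ν) J_ν(x) + x J_ν'(x)`. -/
def dini (ν x : ℝ) : ℝ :=
  (1 - ν) * besselJ ν x + x * deriv (besselJ ν) x

/-- The normalized Bessel function `g_ν(x) = 2^ν Γ(ν+1) x^(1-ν) J_ν(x)`. -/
def normBessel (ν x : ℝ) : ℝ :=
  (2 : ℝ) ^ ν * Real.Gamma (ν + 1) * x ^ (1 - ν) * besselJ ν x

/-- `diniZero ν 0 = 0`, and for `n ≥ 1`, `diniZero ν n` is the `n`-th positive zero of `d_ν`:
the first zero to the right of the previous one. -/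
def diniZero (ν : ℝ) : ℕ → ℝ
  | 0 => 0
  | n + 1 => sInf {x : ℝ | diniZero ν n < x ∧ dini ν x = 0}

/-- The `k`-th interval `(α_{ν,2k}, α_{ν,2k+1})` of the open set `Δ_ν`, which is the union of
these pairwise disjoint intervals over `k ≥ 0`. -/
def deltaInterval (ν : ℝ) (k : ℕ) : Set ℝ :=
  Set.Ioo (diniZero ν (2 * k)) (diniZero ν (2 * k + 1))

/-- A function is log-concave on an interval (a convex set) if it is positive there and its
logarithm is concave there. -/
def LogConcaveOn (s : Set ℝ) (f : ℝ → ℝ) : Prop :=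
  (∀ x ∈ s, 0 < f x) ∧ ConcaveOn ℝ s (fun x => Real.log (f x))

end

/-!
The function `g_ν` is `x j(x)`, where `j(x) = 2^ν Γ(ν+1) x^(-ν) J_ν(x)` is entire, so its
derivative is the even entire function `D = (x j)'`. Up to normalization `j` is the limit of
Laguerre polynomials in `x² / n`. These satisfy a recursion of the form
`p ↦ x p' + (c - b x²) p`, which preserves real-rootedness, and so does differentiation.
Hence `D` is a locally uniform limit of real-rooted polynomials, whose logarithms are
concave between consecutive zeros, and `log D` is concave on every interval where `D` does
not vanish.

`D` is positive on `Δ_ν` because `D(0) = 1` and its positive zeros are infinitely many and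
simple: the zeros of `j` are unbounded by Sturm comparison, those of `D` separate them by
Rolle's theorem, and a double zero of `D` would contradict the positivity of the Turán
expression `J_ν² - J_(ν-1) J_(ν+1)`.

Finally, if `log h` is concave and `f' = h`, then `h(x) h(a+b-x) ≥ h(a) h(b)` on `[a, b]`, so
that `h(x) + h(a+b-x) ≥ 2 √(h(a) h(b))`. Integrating over `[a, b]` gives the inequality.
-/

open Filter Topology Polynomial

/-! ### Functions with log-concave derivative -/

theorem add_le_add_of_concaveOn_of_mem_Icc {s : Set ℝ} {φ : ℝ → ℝ} (hφ : ConcaveOn ℝ s φ)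
    {a b x : ℝ} (ha : a ∈ s) (hb : b ∈ s) (hx : x ∈ Set.Icc a b) :
    φ a + φ b ≤ φ x + φ (a + b - x) := by
  rw [← segment_eq_Icc (hx.1.trans hx.2)] at hx
  obtain ⟨p, q, hp, hq, hpq, rfl⟩ := hx
  have hreflect : a + b - (p • a + q • b) = q • a + p • b := by
    simp only [smul_eq_mul]
    linear_combination -(a + b) * hpq
  have hleft := hφ.2 ha hb hp hq hpq
  have hright := hφ.2 ha hb hq hp ((add_comm q p).trans hpq)
  rw [hreflect]
  simp only [smul_eq_mul] at hleft hright ⊢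
  linear_combination hleft + hright - (φ a + φ b) * hpq

theorem two_mul_sqrt_le_add_of_logConcaveOn {s : Set ℝ} {h : ℝ → ℝ} (hh : LogConcaveOn s h)
    {a b x : ℝ} (ha : a ∈ s) (hb : b ∈ s) (hx : x ∈ Set.Icc a b) :
    2 * √(h a * h b) ≤ h x + h (a + b - x) := by
  have hsub : Set.Icc a b ⊆ s := hh.2.1.ordConnected.out ha hb
  have hx' : a + b - x ∈ Set.Icc a b := ⟨by linarith [hx.2], by linarith [hx.1]⟩
  have hpos {y : ℝ} (hy : y ∈ Set.Icc a b) := hh.1 y (hsub hy)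
  have hprod : h a * h b ≤ h x * h (a + b - x) := by
    rw [← Real.log_le_log_iff (mul_pos (hh.1 a ha) (hh.1 b hb)) (mul_pos (hpos hx) (hpos hx')),
      Real.log_mul (hh.1 a ha).ne' (hh.1 b hb).ne', Real.log_mul (hpos hx).ne' (hpos hx').ne']
    exact add_le_add_of_concaveOn_of_mem_Icc hh.2 ha hb hx
  have hsqrt : √(h a * h b) ≤ (h x + h (a + b - x)) / 2 :=
    Real.sqrt_le_iff.2 ⟨by linarith [hpos hx, hpos hx'],
      hprod.trans (by linarith [sq_nonneg (h x - h (a + b - x))])⟩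
  linarith

theorem mul_sqrt_le_sub_of_logConcaveOn {s : Set ℝ} {f h : ℝ → ℝ} (hh : LogConcaveOn s h)
    (hf : ∀ x ∈ s, HasDerivAt f (h x) x) {a b : ℝ} (ha : a ∈ s) (hb : b ∈ s) (hab : a ≤ b) :
    (b - a) * √(h a * h b) ≤ f b - f a := by
  have hsub : Set.Icc a b ⊆ s := hh.2.1.ordConnected.out ha hb
  have hderiv (x : ℝ) (hx : x ∈ Set.Icc a b) :
      HasDerivAt (fun x => f x - f (a + b - x) - 2 * √(h a * h b) * x)
        (h x + h (a + b - x) - 2 * √(h a * h b)) x := by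
    have hx' : a + b - x ∈ Set.Icc a b := ⟨by linarith [hx.2], by linarith [hx.1]⟩
    refine (((hf x (hsub hx)).sub ((hf _ (hsub hx')).comp_const_sub (a + b) x)).sub
      ((hasDerivAt_id x).const_mul _)).congr_deriv ?_
    ring
  have hmono := monotoneOn_of_hasDerivWithinAt_nonneg (convex_Icc a b)
    (fun x hx => (hderiv x hx).continuousAt.continuousWithinAt)
    (fun x hx => (hderiv x (interior_subset hx)).hasDerivWithinAt)
    fun x hx => sub_nonneg.2 (two_mul_sqrt_le_add_of_logConcaveOn hh ha hb (interior_subset hx))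
  have hends := hmono (Set.left_mem_Icc.2 hab) (Set.right_mem_Icc.2 hab) hab
  simp only [add_sub_cancel_left, add_sub_cancel_right] at hends
  linarith

theorem abs_sub_mul_sqrt_le_of_logConcaveOn {s : Set ℝ} {f h : ℝ → ℝ} (hh : LogConcaveOn s h)
    (hf : ∀ x ∈ s, HasDerivAt f (h x) x) {a b : ℝ} (ha : a ∈ s) (hb : b ∈ s) :
    |a - b| * √(h a * h b) ≤ |f a - f b| := by
  wlog hab : a ≤ b generalizing a b
  · rw [abs_sub_comm a, abs_sub_comm (f a), mul_comm (h a)]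
    exact this hb ha (le_of_not_ge hab)
  rw [abs_sub_comm a, abs_of_nonneg (sub_nonneg.2 hab), abs_sub_comm (f a)]
  exact (mul_sqrt_le_sub_of_logConcaveOn hh hf ha hb hab).trans (le_abs_self _)
/-! ### Real-rooted polynomials -/

theorem concaveOn_log_sub_const {s : Set ℝ} (hs : Convex ℝ s) {a : ℝ} (ha : a ∉ s) :
    ConcaveOn ℝ s fun x => Real.log (x - a) := by
  have hside : s ⊆ Set.Ioi a ∨ s ⊆ Set.Iio a := by
    by_contra! h
    obtain ⟨x, hx, hxa⟩ := Set.not_subset.1 h.1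
    obtain ⟨y, hy, hya⟩ := Set.not_subset.1 h.2
    exact ha (hs.ordConnected.out hx hy ⟨not_lt.1 hxa, not_lt.1 hya⟩)
  rcases hside with h | h
  · refine ((strictConcaveOn_log_Ioi.concaveOn.translate_left (-a)).subset
      (fun x hx => ?_) hs).congr fun x _ => by simp [sub_eq_add_neg]
    simpa using h hx
  · refine ((strictConcaveOn_log_Iio.concaveOn.translate_left (-a)).subset
      (fun x hx => ?_) hs).congr fun x _ => by simp [sub_eq_add_neg]
    simpa using h hx

theorem concaveOn_log_eval_of_splits {p : ℝ[X]} (hp : p.Splits) {s : Set ℝ} (hs : Convex ℝ s)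
    (hne : ∀ x ∈ s, p.eval x ≠ 0) : ConcaveOn ℝ s fun x => Real.log (p.eval x) := by
  induction hp using Submonoid.closure_induction with
  | mem p hp =>
    rcases hp with ⟨c, rfl⟩ | ⟨a, rfl⟩
    · simpa using concaveOn_const _ hs
    · simpa using concaveOn_log_sub_const hs (a := -a) fun ha => hne _ ha (by simp)
  | one => simpa using concaveOn_const _ hs
  | mul p q _ _ ihp ihq =>
    simp only [eval_mul, mul_ne_zero_iff] at hne
    refine ((ihp fun x hx => (hne x hx).1).add (ihq fun x hx => (hne x hx).2)).congr fun x hx => ?_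
    rw [Pi.add_apply, eval_mul, Real.log_mul (hne x hx).1 (hne x hx).2]

theorem eventually_forall_ne_zero_of_tendstoUniformlyOn {ι α E : Type*} [TopologicalSpace α]
    [NormedAddCommGroup E] {l : Filter ι} {F : ι → α → E} {f : α → E} {K : Set α}
    (hlim : TendstoUniformlyOn F f l K) (hK : IsCompact K) (hf : ContinuousOn f K)
    (hne : ∀ x ∈ K, f x ≠ 0) : ∀ᶠ n in l, ∀ x ∈ K, F n x ≠ 0 := by
  rcases K.eq_empty_or_nonempty with rfl | hK'
  · simp
  obtain ⟨x₀, hx₀, hmin⟩ := hK.exists_isMinOn hK' hf.norm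
  filter_upwards [Metric.tendstoUniformlyOn_iff.1 hlim _ (norm_pos_iff.2 (hne x₀ hx₀))]
    with n hn x hx h0
  have hlt := hn x hx
  rw [h0, dist_zero_right] at hlt
  exact (hmin hx).not_gt hlt

theorem concaveOn_log_of_tendstoLocallyUniformlyOn_eval {ι : Type*} {l : Filter ι} [l.NeBot]
    {p : ι → ℝ[X]} {f : ℝ → ℝ} {s : Set ℝ} (hp : ∀ n, (p n).Splits)
    (hlim : TendstoLocallyUniformlyOn (fun n x => (p n).eval x) f l s)
    (hs : Convex ℝ s) (hne : ∀ x ∈ s, f x ≠ 0) : ConcaveOn ℝ s fun x => Real.log (f x) := by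
  refine ⟨hs, fun x hx y hy a b ha hb hab => ?_⟩
  have hlog {z : ℝ} (hz : z ∈ s) :
      Tendsto (fun n => Real.log ((p n).eval z)) l (𝓝 (Real.log (f z))) :=
    (hlim.tendsto_at hz).log (hne z hz)
  have hseg : segment ℝ x y ⊆ s := hs.segment_subset hx hy
  have hcompact : IsCompact (segment ℝ x y) := by rw [segment_eq_uIcc]; exact isCompact_uIcc
  have hcont : ContinuousOn f s :=
    hlim.continuousOn (Frequently.of_forall fun n => (p n).continuous.continuousOn)
  have hpne : ∀ᶠ n in l, ∀ z ∈ segment ℝ x y, (p n).eval z ≠ 0 :=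
    eventually_forall_ne_zero_of_tendstoUniformlyOn
      ((tendstoLocallyUniformlyOn_iff_tendstoUniformlyOn_of_compact hcompact).1 (hlim.mono hseg))
      hcompact (hcont.mono hseg) fun z hz => hne z (hseg hz)
  refine le_of_tendsto_of_tendsto (((hlog hx).const_smul a).add ((hlog hy).const_smul b))
    (hlog (hs hx hy ha hb hab)) ?_
  filter_upwards [hpne] with n hn
  exact (concaveOn_log_eval_of_splits (hp n) (convex_segment x y) hn).2
    (left_mem_segment ℝ x y) (right_mem_segment ℝ x y) ha hb hab

theorem splits_derivative {p : ℝ[X]} (hp : p.Splits) : (derivative p).Splits := by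
  have hroots := splits_iff_card_roots.1 hp
  have hrolle := card_roots_le_derivative p
  have hle := card_roots' (derivative p)
  have hdeg := natDegree_derivative_le p
  rw [splits_iff_card_roots]
  omega

theorem splits_of_forall_im_eq_zero {p : ℝ[X]}
    (h : ∀ z : ℂ, (p.map (algebraMap ℝ ℂ)).eval z = 0 → z.im = 0) : p.Splits := by
  refine Splits.of_splits_map_of_injective (i := algebraMap ℝ ℂ)
    (algebraMap ℝ ℂ).injective (IsAlgClosed.splits _) fun z hz => ⟨z.re, ?_⟩
  exact Complex.ext rfl (h z (isRoot_of_mem_roots hz)).symm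

theorem im_mul_im_logDeriv_nonpos {p : ℝ[X]} (hp : p.Splits) {z : ℂ}
    (hz : (p.map (algebraMap ℝ ℂ)).eval z ≠ 0) :
    z.im * ((derivative (p.map (algebraMap ℝ ℂ))).eval z /
      (p.map (algebraMap ℝ ℂ)).eval z).im ≤ 0 := by
  have hterm (r : ℝ) : z.im * (1 / (z - r)).im ≤ 0 := by
    rw [one_div, Complex.inv_im, Complex.sub_im, Complex.ofReal_im, sub_zero, neg_div, mul_neg,
      ← mul_div_assoc]
    exact neg_nonpos.2 (div_nonneg (mul_self_nonneg _) (Complex.normSq_nonneg _))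
  rw [(hp.map _).eval_derivative_div_eval_of_ne_zero hz,
    hp.roots_map_of_injective (algebraMap ℝ ℂ).injective, Multiset.map_map]
  induction p.roots using Multiset.induction with
  | empty => simp
  | cons r R ih =>
    rw [Multiset.map_cons, Multiset.sum_cons, Complex.add_im, mul_add]
    exact add_nonpos (hterm r) ih

theorem im_eq_zero_of_splits_of_eval_eq_zero {p : ℝ[X]} (hp : p.Splits) (hp0 : p ≠ 0) {z : ℂ}
    (hz : (p.map (algebraMap ℝ ℂ)).eval z = 0) : z.im = 0 := by
  have hmem : z ∈ (p.map (algebraMap ℝ ℂ)).roots :=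
    (mem_roots ((Polynomial.map_ne_zero_iff (algebraMap ℝ ℂ).injective).2 hp0)).2 hz
  rw [hp.roots_map_of_injective (algebraMap ℝ ℂ).injective] at hmem
  obtain ⟨r, -, rfl⟩ := Multiset.mem_map.1 hmem
  exact Complex.ofReal_im r

/- At a nonreal root `z` one would have `p' / p = b z - c / z`, whose imaginary part has the same
sign as that of `z`, against `im_mul_im_logDeriv_nonpos`. -/
theorem splits_X_mul_derivative_add {p : ℝ[X]} (hp : p.Splits) {b c : ℝ} (hb : 0 ≤ b) (hc : 0 < c) :
    (X * derivative p + (C c - C b * X ^ 2) * p).Splits := by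
  rcases eq_or_ne p 0 with rfl | hp0
  · simp
  refine splits_of_forall_im_eq_zero fun z hz => ?_
  by_cases hz0 : (p.map (algebraMap ℝ ℂ)).eval z = 0
  · exact im_eq_zero_of_splits_of_eval_eq_zero hp hp0 hz0
  by_contra him
  have hzne : z ≠ 0 := by rintro rfl; exact him rfl
  have hlog := im_mul_im_logDeriv_nonpos hp hz0
  have hquot : (derivative (p.map (algebraMap ℝ ℂ))).eval z / (p.map (algebraMap ℝ ℂ)).eval z =
      b * z - c / z := by
    simp only [Polynomial.map_add, Polynomial.map_mul, Polynomial.map_sub, map_X, map_C,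
      Polynomial.map_pow, ← derivative_map, eval_add, eval_mul, eval_X, eval_sub, eval_C,
      eval_pow, Complex.coe_algebraMap] at hz
    field_simp
    linear_combination hz
  have him_quot : z.im * (b * z - c / z : ℂ).im =
      b * z.im ^ 2 + c * (z.im ^ 2 / Complex.normSq z) := by
    simp only [Complex.sub_im, Complex.mul_im, Complex.div_im, Complex.ofReal_re, Complex.ofReal_im]
    ring
  rw [hquot, him_quot] at hlog
  have hnorm : 0 < Complex.normSq z := Complex.normSq_pos.2 hzne
  have : 0 < b * z.im ^ 2 + c * (z.im ^ 2 / Complex.normSq z) := by positivity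
  exact this.not_ge hlog

/-! ### The entire function `2^ν Γ(ν+1) x^(-ν) J_ν(x)` -/

theorem hasDerivAt_tsum_mul_pow {𝕜 : Type*} [RCLike 𝕜] {c : ℕ → 𝕜}
    (hc : ∀ r : ℝ, Summable fun k => ‖c k‖ * r ^ k) (x : 𝕜) :
    HasDerivAt (fun y => ∑' k, c k * y ^ k) (∑' k : ℕ, (k + 1) * c (k + 1) * x ^ k) x := by
  set R := ‖x‖ + 1 with hR
  have hR1 : 1 ≤ R := by simp [hR]
  have hbound (k : ℕ) {y : 𝕜} (hy : y ∈ Metric.ball 0 R) :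
      ‖c k * (k * y ^ (k - 1))‖ ≤ ‖c k‖ * (2 * R) ^ k := by
    have hk : (k : ℝ) ≤ 2 ^ k := by exact_mod_cast k.lt_two_pow_self.le
    have hyR : ‖y‖ ^ (k - 1) ≤ R ^ k :=
      (pow_le_pow_left₀ (norm_nonneg y) (mem_ball_zero_iff.1 hy).le _).trans
        (pow_le_pow_right₀ hR1 k.pred_le)
    rw [norm_mul, norm_mul, norm_pow, RCLike.norm_natCast, mul_pow]
    gcongr
  have hderiv : HasDerivAt (fun y => ∑' k, c k * y ^ k) (∑' k : ℕ, c k * (k * x ^ (k - 1))) x :=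
    hasDerivAt_tsum_of_isPreconnected (hc (2 * R)) Metric.isOpen_ball
      (convex_ball (0 : 𝕜) R).isPreconnected (fun k y _ => (hasDerivAt_pow k y).const_mul (c k))
      (fun k y hy => hbound k hy) (Metric.mem_ball_self (by positivity))
      (summable_of_ne_finset_zero (s := {0}) fun k hk => by simp_all) (by simp [hR])
  have hsum : Summable fun k : ℕ => c k * (k * x ^ (k - 1)) :=
    .of_norm_bounded (hc (2 * R)) fun k => hbound k (by simp [hR])
  refine hderiv.congr_deriv ?_
  rw [hsum.tsum_eq_zero_add]
  simp only [Nat.cast_zero, zero_mul, mul_zero, zero_add, Nat.cast_add, Nat.cast_one,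
    Nat.add_sub_cancel]
  exact tsum_congr fun k => by ring

/-- The Taylor coefficients of `2^ν Γ(ν+1) x^(-ν) J_ν(x)` in the variable `x²`. -/
noncomputable def besselCoeff (ν : ℝ) (k : ℕ) : ℝ :=
  (-1) ^ k * Real.Gamma (ν + 1) / (4 ^ k * k.factorial * Real.Gamma (k + ν + 1))

/-- The even entire function `2^ν Γ(ν+1) x^(-ν) J_ν(x)`, normalized to take the value `1` at `0`. -/
noncomputable def besselEntire (ν x : ℝ) : ℝ :=
  ∑' k, besselCoeff ν k * (x ^ 2) ^ k

/-- The even entire function `2^ν Γ(ν+1) x^(-ν) d_ν(x)`. It is written in terms of `J_ν` and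
`J_(ν+1)`, so that the contiguous relations apply to it. -/
noncomputable def diniEntire (ν x : ℝ) : ℝ :=
  besselEntire ν x - x ^ 2 / (2 * (ν + 1)) * besselEntire (ν + 1) x

section Bessel

variable {ν : ℝ} (hν : -1 < ν)
include hν

theorem gamma_natCast_add_pos (k : ℕ) : 0 < Real.Gamma (k + ν + 1) :=
  Real.Gamma_pos_of_pos (by linarith [k.cast_nonneg (α := ℝ)])

theorem gamma_add_one_pos : 0 < Real.Gamma (ν + 1) :=
  Real.Gamma_pos_of_pos (by linarith)

theorem besselCoeff_zero : besselCoeff ν 0 = 1 := by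
  have hΓ := (gamma_add_one_pos hν).ne'
  simp [besselCoeff, hΓ]

theorem besselCoeff_succ (k : ℕ) :
    4 * (k + 1) * (k + 1 + ν) * besselCoeff ν (k + 1) = -besselCoeff ν k := by
  have hΓ := (gamma_natCast_add_pos hν k).ne'
  have hk : (k : ℝ) + ν + 1 ≠ 0 := by linarith [k.cast_nonneg (α := ℝ)]
  have hΓ_succ : Real.Gamma ((k + 1 : ℕ) + ν + 1) = (k + ν + 1) * Real.Gamma (k + ν + 1) := by
    rw [← Real.Gamma_add_one hk]
    push_cast
    ring_nf
  rw [besselCoeff, besselCoeff, hΓ_succ, Nat.factorial_succ]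
  push_cast
  field_simp
  ring

theorem besselCoeff_order_succ (k : ℕ) :
    (ν + 1 + k) * besselCoeff (ν + 1) k = (ν + 1) * besselCoeff ν k := by
  have hν1 : ν + 1 ≠ 0 := by linarith
  have hΓ := (gamma_natCast_add_pos hν k).ne'
  have hk : (k : ℝ) + ν + 1 ≠ 0 := by linarith [k.cast_nonneg (α := ℝ)]
  rw [besselCoeff, besselCoeff, ← add_assoc (k : ℝ) ν 1, Real.Gamma_add_one hν1,
    Real.Gamma_add_one hk]
  field_simp
  ring

theorem succ_mul_besselCoeff_succ (k : ℕ) :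
    (k + 1) * besselCoeff ν (k + 1) = -(4 * (ν + 1))⁻¹ * besselCoeff (ν + 1) k := by
  have hν1 : ν + 1 ≠ 0 := by linarith
  have hk : ν + 1 + k ≠ 0 := by linarith [k.cast_nonneg (α := ℝ)]
  have hsucc := besselCoeff_succ hν k
  have horder := besselCoeff_order_succ hν k
  have hmul : 4 * (ν + 1) * ((k + 1) * besselCoeff ν (k + 1)) = -besselCoeff (ν + 1) k :=
    mul_left_cancel₀ hk (by linear_combination (ν + 1) * hsucc + horder)
  field_simp
  linear_combination hmul

theorem besselCoeff_ne_zero (k : ℕ) : besselCoeff ν k ≠ 0 := by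
  have hΓ := (gamma_add_one_pos hν).ne'
  have hΓk := (gamma_natCast_add_pos hν k).ne'
  unfold besselCoeff
  positivity

theorem norm_besselCoeff_succ (k : ℕ) :
    ‖besselCoeff ν (k + 1)‖ = ‖besselCoeff ν k‖ / (4 * (k + 1) * (k + 1 + ν)) := by
  have hpos : 0 < 4 * ((k : ℝ) + 1) * (k + 1 + ν) :=
    mul_pos (by positivity) (by linarith [k.cast_nonneg (α := ℝ)])
  rw [eq_div_iff hpos.ne', ← norm_neg (besselCoeff ν k), ← besselCoeff_succ hν, norm_mul,
    Real.norm_of_nonneg hpos.le, mul_comm]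

theorem summable_norm_besselCoeff_mul_pow (r : ℝ) :
    Summable fun k => ‖besselCoeff ν k‖ * r ^ k := by
  rcases eq_or_ne r 0 with rfl | hr
  · exact summable_of_ne_finset_zero (s := {0}) fun k hk => by simp_all
  have hlin (a : ℝ) : Tendsto (fun k : ℕ => (k : ℝ) + a) atTop atTop :=
    tendsto_natCast_atTop_atTop.atTop_add tendsto_const_nhds
  have hden : Tendsto (fun k : ℕ => 4 * ((k : ℝ) + 1) * (k + 1 + ν)) atTop atTop := by
    simp only [add_assoc]
    exact ((hlin 1).const_mul_atTop four_pos).atTop_mul_atTop₀ (hlin (1 + ν))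
  refine summable_of_ratio_test_tendsto_lt_one zero_lt_one (.of_forall fun k =>
    mul_ne_zero (norm_ne_zero_iff.2 (besselCoeff_ne_zero hν k)) (pow_ne_zero k hr))
    ((hden.const_div_atTop |r|).congr fun k => ?_)
  have hpos : 0 < 4 * ((k : ℝ) + 1) * (k + 1 + ν) :=
    mul_pos (by positivity) (by linarith [k.cast_nonneg (α := ℝ)])
  have hc := norm_ne_zero_iff.2 (besselCoeff_ne_zero hν k)
  have hr' := abs_ne_zero.2 hr
  simp only [norm_besselCoeff_succ hν, norm_mul, norm_norm, norm_div, norm_pow,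
    Real.norm_of_nonneg hpos.le, Real.norm_eq_abs r, pow_succ]
  field_simp

theorem summable_besselCoeff_mul_pow (r : ℝ) : Summable fun k => besselCoeff ν k * r ^ k :=
  .of_norm_bounded (summable_norm_besselCoeff_mul_pow hν |r|) fun k => by
    rw [norm_mul, norm_pow, Real.norm_eq_abs r]

theorem besselEntire_zero : besselEntire ν 0 = 1 := by
  rw [besselEntire, tsum_eq_single 0 fun k hk => by simp [hk], besselCoeff_zero hν]
  simp

theorem hasDerivAt_besselEntire (x : ℝ) :
    HasDerivAt (besselEntire ν) (-(x / (2 * (ν + 1))) * besselEntire (ν + 1) x) x := by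
  have hν1 : ν + 1 ≠ 0 := by linarith
  refine ((hasDerivAt_tsum_mul_pow (summable_norm_besselCoeff_mul_pow hν) (x ^ 2)).comp x
    (hasDerivAt_pow 2 x)).congr_deriv ?_
  simp only [succ_mul_besselCoeff_succ hν, mul_assoc, tsum_mul_left]
  rw [← besselEntire]
  push_cast
  field_simp
  ring

theorem continuous_besselEntire : Continuous (besselEntire ν) :=
  continuous_iff_continuousAt.2 fun x => (hasDerivAt_besselEntire hν x).continuousAt

theorem besselEntire_sub_besselEntire_add_one (x : ℝ) :
    besselEntire ν x - besselEntire (ν + 1) x =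
      -(x ^ 2 / (4 * (ν + 1) * (ν + 2))) * besselEntire (ν + 2) x := by
  have hν1 : ν + 1 ≠ 0 := by linarith
  have hν2 : ν + 2 ≠ 0 := by linarith
  have hcoeff (k : ℕ) : besselCoeff ν (k + 1) - besselCoeff (ν + 1) (k + 1) =
      -(4 * (ν + 1) * (ν + 2))⁻¹ * besselCoeff (ν + 2) k := by
    have horder := besselCoeff_order_succ hν (k + 1)
    have hsucc := succ_mul_besselCoeff_succ (ν := ν + 1) (by linarith) k
    rw [show ν + 1 + 1 = ν + 2 by ring] at hsucc
    field_simp at hsucc ⊢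
    push_cast at horder
    linear_combination hsucc - 4 * (ν + 2) * horder
  have hs := summable_besselCoeff_mul_pow hν (x ^ 2)
  have hs1 := summable_besselCoeff_mul_pow (ν := ν + 1) (by linarith) (x ^ 2)
  rw [besselEntire, besselEntire, ← hs.tsum_sub hs1, (hs.sub hs1).tsum_eq_zero_add,
    besselCoeff_zero hν, besselCoeff_zero (by linarith), sub_self, zero_add, besselEntire,
    ← tsum_mul_left]
  refine tsum_congr fun k => ?_
  rw [← sub_mul, hcoeff, pow_succ]
  ring

theorem hasDerivAt_besselEntire_add_one {x : ℝ} (hx : x ≠ 0) :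
    HasDerivAt (besselEntire (ν + 1))
      (2 * (ν + 1) / x * (besselEntire ν x - besselEntire (ν + 1) x)) x := by
  have hν1 : ν + 1 ≠ 0 := by linarith
  have hν2 : ν + 2 ≠ 0 := by linarith
  refine (hasDerivAt_besselEntire (ν := ν + 1) (by linarith) x).congr_deriv ?_
  rw [besselEntire_sub_besselEntire_add_one hν, show ν + 1 + 1 = ν + 2 by ring]
  field_simp
  ring

theorem hasDerivAt_id_mul_besselEntire (x : ℝ) :
    HasDerivAt (fun y => y * besselEntire ν y) (diniEntire ν x) x := by
  refine ((hasDerivAt_id x).mul (hasDerivAt_besselEntire hν x)).congr_deriv ?_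
  rw [diniEntire, id]
  ring

theorem hasDerivAt_diniEntire {x : ℝ} (hx : x ≠ 0) :
    HasDerivAt (diniEntire ν)
      (-x * (besselEntire ν x + (1 - 2 * ν) / (2 * (ν + 1)) * besselEntire (ν + 1) x)) x := by
  have hν1 : ν + 1 ≠ 0 := by linarith
  refine ((hasDerivAt_besselEntire hν x).sub (((hasDerivAt_pow 2 x).div_const (2 * (ν + 1))).mul
    (hasDerivAt_besselEntire_add_one hν hx))).congr_deriv ?_
  push_cast
  field_simp
  ring

theorem diniEntire_zero : diniEntire ν 0 = 1 := by
  simp [diniEntire, besselEntire_zero hν]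

theorem continuous_diniEntire : Continuous (diniEntire ν) :=
  (continuous_besselEntire hν).sub
    (((continuous_pow 2).div_const _).mul (continuous_besselEntire (by linarith)))

theorem hasSum_diniEntire (x : ℝ) :
    HasSum (fun k : ℕ => (2 * k + 1) * besselCoeff ν k * (x ^ 2) ^ k) (diniEntire ν x) := by
  have hJ : HasSum (fun k => besselCoeff ν k * (x ^ 2) ^ k) (besselEntire ν x) :=
    (summable_besselCoeff_mul_pow hν (x ^ 2)).hasSum
  have hJ_succ : HasSum (fun k => besselCoeff (ν + 1) k * (x ^ 2) ^ k) (besselEntire (ν + 1) x) :=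
    (summable_besselCoeff_mul_pow (by linarith) (x ^ 2)).hasSum
  have hEuler : HasSum (fun k : ℕ => 2 * k * besselCoeff ν k * (x ^ 2) ^ k)
      (-(x ^ 2 / (2 * (ν + 1))) * besselEntire (ν + 1) x) := by
    have hterm (k : ℕ) : 2 * ((k + 1 : ℕ) : ℝ) * besselCoeff ν (k + 1) * (x ^ 2) ^ (k + 1) =
        -(x ^ 2 / (2 * (ν + 1))) * (besselCoeff (ν + 1) k * (x ^ 2) ^ k) := by
      rw [Nat.cast_succ, mul_assoc 2, succ_mul_besselCoeff_succ hν, pow_succ]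
      field_simp
      ring
    rw [← hasSum_nat_add_iff' 1, Finset.sum_range_one, Nat.cast_zero, mul_zero, zero_mul, zero_mul,
      sub_zero]
    simp only [hterm]
    exact hJ_succ.mul_left _
  convert hJ.add hEuler using 1
  · ext k; ring
  · rw [diniEntire]; ring

end Bessel

/-! ### Approximation by Laguerre polynomials -/

theorem tendstoUniformlyOn_tsum_mul {α E : Type*} [NormedAddCommGroup E] [NormedSpace ℝ E]
    [CompleteSpace E] {μ : ℕ → ℕ → ℝ} {f : ℕ → α → E} {u : ℕ → ℝ} {s : Set α} (hu : Summable u)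
    (hf : ∀ k, ∀ x ∈ s, ‖f k x‖ ≤ u k) (hμ : ∀ n k, μ n k ∈ Set.Icc 0 1)
    (hμ_lim : ∀ k, Tendsto (μ · k) atTop (𝓝 1)) :
    TendstoUniformlyOn (fun n x => ∑' k, μ n k • f k x) (fun x => ∑' k, f k x) atTop s := by
  rcases s.eq_empty_or_nonempty with rfl | ⟨x₀, hx₀⟩
  · exact tendstoUniformlyOn_empty
  have hu0 (k : ℕ) : 0 ≤ u k := (norm_nonneg _).trans (hf k x₀ hx₀)
  have hweight (n k : ℕ) : (1 - μ n k) * u k ≤ u k :=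
    mul_le_of_le_one_left (hu0 k) (by linarith [(hμ n k).1])
  have hweight0 (n k : ℕ) : 0 ≤ (1 - μ n k) * u k :=
    mul_nonneg (by linarith [(hμ n k).2]) (hu0 k)
  have herr : Tendsto (fun n => ∑' k, (1 - μ n k) * u k) atTop (𝓝 0) := by
    simpa using tendsto_tsum_of_dominated_convergence (f := fun n k => (1 - μ n k) * u k) hu
      (fun k => ((hμ_lim k).const_sub 1).mul_const (u k))
      (.of_forall fun n k => by rw [Real.norm_of_nonneg (hweight0 n k)]; exact hweight n k)
  refine Metric.tendstoUniformlyOn_iff.2 fun ε hε => ?_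
  filter_upwards [herr.eventually_lt_const hε] with n hn x hx
  have hterm (k : ℕ) : ‖f k x - μ n k • f k x‖ ≤ (1 - μ n k) * u k := by
    rw [show f k x - μ n k • f k x = (1 - μ n k) • f k x by rw [sub_smul, one_smul], norm_smul,
      Real.norm_of_nonneg (by linarith [(hμ n k).2])]
    exact mul_le_mul_of_nonneg_left (hf k x hx) (by linarith [(hμ n k).2])
  have hsum : Summable fun k => f k x := .of_norm_bounded hu fun k => hf k x hx
  have hsum_diff : Summable fun k => f k x - μ n k • f k x :=
    .of_norm_bounded hu fun k => (hterm k).trans (hweight n k)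
  have hsum_smul : Summable fun k => μ n k • f k x := by simpa using hsum.sub hsum_diff
  rw [dist_eq_norm, ← hsum.tsum_sub hsum_smul]
  exact (tsum_of_norm_bounded (hu.of_nonneg_of_le (hweight0 n) (hweight n)).hasSum hterm).trans_lt
    hn

theorem cast_descFactorial_succ {R : Type*} [CommRing R] (n k : ℕ) :
    (n.descFactorial (k + 1) : R) = n.descFactorial k * (n - k) := by
  rw [← descPochhammer_eval_eq_descFactorial R, ← descPochhammer_eval_eq_descFactorial R,
    descPochhammer_succ_eval]

theorem tendsto_descFactorial_div_pow (k : ℕ) :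
    Tendsto (fun n : ℕ => (n.descFactorial k : ℝ) / n ^ k) atTop (𝓝 1) := by
  refine (Asymptotics.isEquivalent_iff_tendsto_one ?_).1 (isEquivalent_descFactorial k)
  filter_upwards [eventually_gt_atTop 0] with n hn
  positivity

theorem descFactorial_div_pow_mem_Icc (n k : ℕ) :
    (n.descFactorial k : ℝ) / n ^ k ∈ Set.Icc 0 1 := by
  refine ⟨by positivity, div_le_one_of_le₀ ?_ (by positivity)⟩
  exact_mod_cast n.descFactorial_le_pow k

/-- The Laguerre polynomial of order `ν` and degree `n` with argument rescaled to `r X / 4`,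
normalized to take the value `1` at the origin. -/
noncomputable def laguerrePoly (ν r : ℝ) (n : ℕ) : ℝ[X] :=
  ∑ k ∈ Finset.range (n + 1), C (n.descFactorial k * r ^ k * besselCoeff ν k) * X ^ k

theorem coeff_laguerrePoly (ν r : ℝ) (n k : ℕ) :
    (laguerrePoly ν r n).coeff k = n.descFactorial k * r ^ k * besselCoeff ν k := by
  simp only [laguerrePoly, finsetSum_coeff, coeff_C_mul_X_pow, Finset.sum_ite_eq]
  split_ifs with hk
  · rfl
  · simp [Nat.descFactorial_of_lt (show n < k by simpa using hk)]

/-- The polynomial `(X L(X²))'`, where `L` is the Laguerre polynomial of degree `n` with the scaling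
`r = 1 / n` for which `L(X²)` converges to `besselEntire ν`. -/
noncomputable def diniPoly (ν : ℝ) (n : ℕ) : ℝ[X] :=
  derivative (X * expand ℝ 2 (laguerrePoly ν (n : ℝ)⁻¹ n))

theorem diniPoly_eq_sum (ν : ℝ) (n : ℕ) : diniPoly ν n = ∑ k ∈ Finset.range (n + 1),
    C (n.descFactorial k / n ^ k * ((2 * k + 1) * besselCoeff ν k)) * X ^ (2 * k) := by
  rw [diniPoly, laguerrePoly, map_sum, Finset.mul_sum, derivative_sum]
  refine Finset.sum_congr rfl fun k _ => ?_
  rw [map_mul (expand ℝ 2), expand_C, map_pow, expand_X, ← pow_mul, mul_left_comm, ← pow_succ',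
    derivative_C_mul_X_pow, Nat.add_sub_cancel]
  push_cast
  ring_nf

section Bessel

variable {ν : ℝ} (hν : -1 < ν)
include hν

theorem laguerrePoly_succ (r : ℝ) (n : ℕ) :
    C (n + 1 + ν) * laguerrePoly ν r (n + 1) = X * derivative (laguerrePoly ν r n) +
      (C (n + 1 + ν) - C (r / 4) * X) * laguerrePoly ν r n := by
  ext k
  cases k with
  | zero => simp [sub_mul, mul_assoc, coeff_laguerrePoly]
  | succ k =>
    simp only [coeff_add, coeff_C_mul, coeff_X_mul, coeff_derivative, sub_mul, coeff_sub,
      coeff_laguerrePoly, mul_assoc, Nat.succ_descFactorial_succ, cast_descFactorial_succ]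
    push_cast
    linear_combination (n.descFactorial k * r ^ (k + 1) / 4 : ℝ) * besselCoeff_succ hν k

theorem splits_expand_laguerrePoly {r : ℝ} (hr : 0 ≤ r) (n : ℕ) :
    (expand ℝ 2 (laguerrePoly ν r n)).Splits := by
  induction n with
  | zero => simp [laguerrePoly]
  | succ n ih =>
    have hc : 0 < 2 * ((n : ℝ) + 1 + ν) := by linarith [n.cast_nonneg (α := ℝ)]
    have hrec : C (2 * (n + 1 + ν)) * expand ℝ 2 (laguerrePoly ν r (n + 1)) =
        X * derivative (expand ℝ 2 (laguerrePoly ν r n)) +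
          (C (2 * (n + 1 + ν)) - C (r / 2) * X ^ 2) * expand ℝ 2 (laguerrePoly ν r n) := by
      have h := congrArg (expand ℝ 2) (laguerrePoly_succ hν r n)
      simp only [map_mul (expand ℝ 2), map_add (expand ℝ 2), map_sub (expand ℝ 2), expand_C,
        expand_X] at h
      rw [show r / 2 = 2 * (r / 4) by ring, C_mul, C_mul, derivative_expand, map_ofNat C 2]
      push_cast
      linear_combination 2 * h
    have hsplit := (splits_X_mul_derivative_add ih (b := r / 2) (by positivity) hc).C_mul
      (2 * (n + 1 + ν))⁻¹
    rwa [← hrec, ← mul_assoc, ← C_mul, inv_mul_cancel₀ hc.ne', C_1, one_mul] at hsplit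

theorem splits_diniPoly (n : ℕ) : (diniPoly ν n).Splits :=
  splits_derivative (Splits.X.mul (splits_expand_laguerrePoly hν (by positivity) n))

theorem tendstoLocallyUniformly_diniPoly :
    TendstoLocallyUniformly (fun n x => (diniPoly ν n).eval x) (diniEntire ν) atTop := by
  have heval (n : ℕ) (x : ℝ) : (diniPoly ν n).eval x = ∑' k : ℕ,
      (n.descFactorial k / n ^ k : ℝ) • ((2 * k + 1) * besselCoeff ν k * (x ^ 2) ^ k) := by
    rw [tsum_eq_sum (s := Finset.range (n + 1)) fun k hk => by
      simp [Nat.descFactorial_of_lt (show n < k by simpa using hk)], diniPoly_eq_sum,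
      eval_finsetSum]
    refine Finset.sum_congr rfl fun k _ => ?_
    rw [eval_C_mul, eval_pow, eval_X, smul_eq_mul]
    ring
  have hlimit : diniEntire ν = fun x => ∑' k : ℕ, (2 * k + 1) * besselCoeff ν k * (x ^ 2) ^ k :=
    funext fun x => (hasSum_diniEntire hν x).tsum_eq.symm
  refine tendstoLocallyUniformly_of_forall_exists_nhds fun x =>
    ⟨Metric.ball 0 (|x| + 1), Metric.isOpen_ball.mem_nhds (by simp), ?_⟩
  simp only [heval]
  rw [hlimit]
  refine tendstoUniformlyOn_tsum_mul (hasSum_diniEntire hν (|x| + 1)).summable.norm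
    (fun k y hy => ?_) descFactorial_div_pow_mem_Icc tendsto_descFactorial_div_pow
  have hyx : ‖y‖ ≤ ‖|x| + 1‖ := (mem_ball_zero_iff.1 hy).le.trans (Real.le_norm_self _)
  simp only [norm_mul, norm_pow]
  gcongr

theorem concaveOn_log_diniEntire {s : Set ℝ} (hs : Convex ℝ s)
    (hne : ∀ x ∈ s, diniEntire ν x ≠ 0) : ConcaveOn ℝ s fun x => Real.log (diniEntire ν x) :=
  concaveOn_log_of_tendstoLocallyUniformlyOn_eval (splits_diniPoly hν)
    (tendstoLocallyUniformly_diniPoly hν).tendstoLocallyUniformlyOn hs hne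

end Bessel

/-! ### Zeros of the Dini function -/

/- The Wronskian of `u` and `Real.sin (ω (x - a))` would be nonincreasing, against its values at the
two ends of the interval. -/
theorem exists_nonpos_of_sturm {u v q : ℝ → ℝ} {a ω : ℝ} (hω : 0 < ω)
    (hu : ∀ x ∈ Set.Icc a (a + Real.pi / ω), HasDerivAt u (v x) x)
    (hv : ∀ x ∈ Set.Icc a (a + Real.pi / ω), HasDerivAt v (-(q x) * u x) x)
    (hq : ∀ x ∈ Set.Icc a (a + Real.pi / ω), ω ^ 2 ≤ q x) :
    ∃ x ∈ Set.Icc a (a + Real.pi / ω), u x ≤ 0 := by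
  by_contra! hpos
  have hle : a ≤ a + Real.pi / ω := by linarith [div_pos Real.pi_pos hω]
  have hmem {x : ℝ} (hx : x ∈ interior (Set.Icc a (a + Real.pi / ω))) := interior_subset hx
  have hW (x : ℝ) (hx : x ∈ Set.Icc a (a + Real.pi / ω)) :
      HasDerivAt (fun x => v x * Real.sin (ω * (x - a)) - u x * (ω * Real.cos (ω * (x - a))))
        ((ω ^ 2 - q x) * u x * Real.sin (ω * (x - a))) x := by
    have hphase : HasDerivAt (fun x => ω * (x - a)) ω x := by
      simpa using ((hasDerivAt_id x).sub_const a).const_mul ω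
    refine (((hv x hx).mul hphase.sin).sub
      ((hu x hx).mul (hphase.cos.const_mul ω))).congr_deriv ?_
    ring
  have hsin {x : ℝ} (hx : x ∈ Set.Icc a (a + Real.pi / ω)) : 0 ≤ Real.sin (ω * (x - a)) := by
    refine Real.sin_nonneg_of_nonneg_of_le_pi (mul_nonneg hω.le (by linarith [hx.1])) ?_
    have hxπ : x - a ≤ Real.pi / ω := by linarith [hx.2]
    rwa [le_div_iff₀' hω] at hxπ
  have hanti := antitoneOn_of_hasDerivWithinAt_nonpos (convex_Icc a (a + Real.pi / ω))
    (fun x hx => (hW x hx).continuousAt.continuousWithinAt)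
    (fun x hx => (hW x (hmem hx)).hasDerivWithinAt) fun x hx =>
      mul_nonpos_of_nonpos_of_nonneg (mul_nonpos_of_nonpos_of_nonneg
        (sub_nonpos.2 (hq x (hmem hx))) (hpos x (hmem hx)).le) (hsin (hmem hx))
  have hends := hanti (Set.left_mem_Icc.2 hle) (Set.right_mem_Icc.2 hle) hle
  beta_reduce at hends
  rw [sub_self, mul_zero, add_sub_cancel_left, mul_div_cancel₀ _ hω.ne', Real.sin_pi, Real.sin_zero,
    Real.cos_pi, Real.cos_zero] at hends
  have ha := mul_pos (hpos a (Set.left_mem_Icc.2 hle)) hω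
  have hb := mul_pos (hpos (a + Real.pi / ω) (Set.right_mem_Icc.2 hle)) hω
  linarith

theorem exists_eq_zero_of_sturm {u v q : ℝ → ℝ} {a ω : ℝ} (hω : 0 < ω)
    (hu : ∀ x ∈ Set.Icc a (a + Real.pi / ω), HasDerivAt u (v x) x)
    (hv : ∀ x ∈ Set.Icc a (a + Real.pi / ω), HasDerivAt v (-(q x) * u x) x)
    (hq : ∀ x ∈ Set.Icc a (a + Real.pi / ω), ω ^ 2 ≤ q x) :
    ∃ x ∈ Set.Icc a (a + Real.pi / ω), u x = 0 := by
  obtain ⟨x, hx, hux⟩ := exists_nonpos_of_sturm hω hu hv hq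
  obtain ⟨y, hy, huy⟩ := exists_nonpos_of_sturm (u := -u) (v := -v) hω
    (fun x hx => (hu x hx).neg) (fun x hx => (hv x hx).neg.congr_deriv (by simp)) hq
  exact isPreconnected_Icc.intermediate_value hx hy
    (fun z hz => (hu z hz).continuousAt.continuousWithinAt) ⟨hux, by simpa using huy⟩

section Bessel

variable {ν : ℝ} (hν : -1 < ν)
include hν

/- Up to a constant factor `u` is `√x J_ν(x)`, which solves `u'' + (1 + (1/4 - ν²) / x²) u = 0`. -/
theorem exists_besselEntire_eq_zero (M : ℝ) : ∃ x, M < x ∧ besselEntire ν x = 0 := by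
  have hν1 : ν + 1 ≠ 0 := by linarith
  set a := max (2 * |ν|) (max 1 (M + 1))
  have hνa : 2 * |ν| ≤ a := le_max_left _ _
  have ha1 : 1 ≤ a := (le_max_left _ _).trans (le_max_right _ _)
  have hMa : M + 1 ≤ a := (le_max_right _ _).trans (le_max_right _ _)
  have hpos {x : ℝ} (hx : x ∈ Set.Icc a (a + Real.pi / (1 / 2))) : 0 < x := by linarith [hx.1]
  have hu (x : ℝ) (hx : x ∈ Set.Icc a (a + Real.pi / (1 / 2))) :
      HasDerivAt (fun x => x ^ (ν - 1 / 2) * x * besselEntire ν x) (x ^ (ν - 1 / 2) *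
        ((ν + 1 / 2) * besselEntire ν x - x ^ 2 / (2 * (ν + 1)) * besselEntire (ν + 1) x)) x := by
    have hx0 := (hpos hx).ne'
    refine (((Real.hasDerivAt_rpow_const (Or.inl hx0)).mul (hasDerivAt_id x)).mul
      (hasDerivAt_besselEntire hν x)).congr_deriv ?_
    simp only [id, Pi.mul_apply, Real.rpow_sub_one hx0]
    field_simp
    ring
  have hv (x : ℝ) (hx : x ∈ Set.Icc a (a + Real.pi / (1 / 2))) :
      HasDerivAt (fun x => x ^ (ν - 1 / 2) *
        ((ν + 1 / 2) * besselEntire ν x - x ^ 2 / (2 * (ν + 1)) * besselEntire (ν + 1) x))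
        (-(1 + (1 / 4 - ν ^ 2) / x ^ 2) * (x ^ (ν - 1 / 2) * x * besselEntire ν x)) x := by
    have hx0 := (hpos hx).ne'
    refine ((Real.hasDerivAt_rpow_const (Or.inl hx0)).mul
      (((hasDerivAt_besselEntire hν x).const_mul (ν + 1 / 2)).sub
        (((hasDerivAt_pow 2 x).div_const (2 * (ν + 1))).mul
          (hasDerivAt_besselEntire_add_one hν hx0)))).congr_deriv ?_
    simp only [Pi.sub_apply, Pi.mul_apply, Real.rpow_sub_one hx0, Nat.cast_ofNat]
    field_simp
    ring
  have hq (x : ℝ) (hx : x ∈ Set.Icc a (a + Real.pi / (1 / 2))) :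
      (1 / 2) ^ 2 ≤ 1 + (1 / 4 - ν ^ 2) / x ^ 2 := by
    have hx0 := hpos hx
    have hνx : (2 * |ν|) ^ 2 ≤ x ^ 2 := pow_le_pow_left₀ (by positivity) (hνa.trans hx.1) 2
    rw [mul_pow, sq_abs] at hνx
    rw [← sub_nonneg, show 1 + (1 / 4 - ν ^ 2) / x ^ 2 - (1 / 2) ^ 2 =
      (3 * x ^ 2 + 1 - 4 * ν ^ 2) / (4 * x ^ 2) by field_simp; ring]
    exact div_nonneg (by nlinarith) (by positivity)
  obtain ⟨x, hx, hx0⟩ := exists_eq_zero_of_sturm one_half_pos hu hv hq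
  have hx' := hpos hx
  exact ⟨x, by linarith [hx.1],
    (mul_eq_zero.1 hx0).resolve_left (mul_pos (Real.rpow_pos_of_pos hx' _) hx').ne'⟩

theorem exists_diniEntire_eq_zero (M : ℝ) : ∃ x, M < x ∧ diniEntire ν x = 0 := by
  obtain ⟨x, hMx, hx⟩ := exists_besselEntire_eq_zero hν M
  obtain ⟨y, hxy, hy⟩ := exists_besselEntire_eq_zero hν x
  obtain ⟨z, hz, hz0⟩ := exists_hasDerivAt_eq_zero (f := fun t => t * besselEntire ν t) hxy
    (continuous_id.mul (continuous_besselEntire hν)).continuousOn (by simp [hx, hy])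
    fun t _ => hasDerivAt_id_mul_besselEntire hν t
  exact ⟨z, hMx.trans hz.1, hz0⟩

/-- Turán's expression `J_ν² - J_(ν-1) J_(ν+1)`, multiplied by the square of `2^ν Γ(ν+1) x^(-ν)`. -/
noncomputable def besselTuran (ν x : ℝ) : ℝ :=
  besselEntire ν x ^ 2 - ν / (ν + 1) * (besselEntire ν x * besselEntire (ν + 1) x) +
    (x / (2 * (ν + 1)) * besselEntire (ν + 1) x) ^ 2

theorem hasDerivAt_rpow_mul_besselTuran {x : ℝ} (hx : 0 < x) :
    HasDerivAt (fun y => y ^ (2 * ν + 2) * besselTuran ν y)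
      (2 * x ^ (2 * ν + 1) * besselEntire ν x ^ 2) x := by
  have hν1 : ν + 1 ≠ 0 := by linarith
  have hj := hasDerivAt_besselEntire hν x
  have hj₁ := hasDerivAt_besselEntire_add_one hν hx.ne'
  refine ((Real.hasDerivAt_rpow_const (p := 2 * ν + 2) (Or.inl hx.ne')).mul
    (((hj.pow 2).sub ((hj.mul hj₁).const_mul (ν / (ν + 1)))).add
      ((((hasDerivAt_id x).div_const (2 * (ν + 1))).mul hj₁).pow 2))).congr_deriv ?_
  have hpow : x ^ (2 * ν + 2) = x ^ (2 * ν + 1) * x := by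
    rw [← Real.rpow_add_one hx.ne']
    ring_nf
  simp only [id, Pi.mul_apply, Pi.add_apply, Pi.sub_apply, Pi.pow_apply, Nat.cast_ofNat, hpow,
    Nat.add_one_sub_one, pow_one,
    show 2 * ν + 2 - 1 = 2 * ν + 1 by ring]
  field_simp
  ring

theorem continuous_besselTuran : Continuous (besselTuran ν) := by
  have hj := continuous_besselEntire hν
  have hj₁ := continuous_besselEntire (ν := ν + 1) (by linarith)
  unfold besselTuran
  fun_prop

theorem besselTuran_zero : besselTuran ν 0 = (ν + 1)⁻¹ := by
  have hν1 : ν + 1 ≠ 0 := by linarith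
  simp only [besselTuran, besselEntire_zero hν, besselEntire_zero (ν := ν + 1) (by linarith)]
  field_simp
  ring

theorem besselTuran_pos {x : ℝ} (hx : 0 < x) : 0 < besselTuran ν x := by
  have hmono : MonotoneOn (fun y => y ^ (2 * ν + 2) * besselTuran ν y) (Set.Ioi 0) :=
    monotoneOn_of_hasDerivWithinAt_nonneg (convex_Ioi 0)
      (fun y hy => (hasDerivAt_rpow_mul_besselTuran hν hy).continuousAt.continuousWithinAt)
      (fun y hy => (hasDerivAt_rpow_mul_besselTuran hν (interior_subset hy)).hasDerivWithinAt)
      fun y hy => by have : 0 < y := interior_subset hy; positivity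
  have hnear : ∀ᶠ y in 𝓝[>] 0, 0 < besselTuran ν y :=
    ((continuous_besselTuran hν).continuousAt.eventually_const_lt (by
      rw [besselTuran_zero hν]; exact inv_pos.2 (by linarith))).filter_mono nhdsWithin_le_nhds
  obtain ⟨y, hy, hy0, hyx⟩ := (hnear.and (Ioo_mem_nhdsGT hx)).exists
  have hle := hmono hy0 hx hyx.le
  exact pos_of_mul_pos_right ((mul_pos (Real.rpow_pos_of_pos hy0 _) hy).trans_le hle)
    (Real.rpow_pos_of_pos hx _).le

theorem besselTuran_eq (x : ℝ) : besselTuran ν x =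
    besselEntire ν x *
      (besselEntire ν x + (1 - 2 * ν) / (2 * (ν + 1)) * besselEntire (ν + 1) x) -
    besselEntire (ν + 1) x / (2 * (ν + 1)) * diniEntire ν x := by
  have hν1 : ν + 1 ≠ 0 := by linarith
  rw [besselTuran, diniEntire]
  field_simp
  ring

theorem deriv_diniEntire_ne_zero {x : ℝ} (hx : 0 < x) (h0 : diniEntire ν x = 0) :
    deriv (diniEntire ν) x ≠ 0 := by
  rw [(hasDerivAt_diniEntire hν hx.ne').deriv]
  intro h1
  have hturan := besselTuran_pos hν hx
  rw [besselTuran_eq hν, h0, (mul_eq_zero.1 h1).resolve_left (neg_ne_zero.2 hx.ne')] at hturan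
  simp at hturan

end Bessel

/-! ### The derivative of the normalized Bessel function -/

section Bessel

variable {ν : ℝ} (hν : -1 < ν)
include hν

theorem two_rpow_mul_gamma_pos : 0 < (2 : ℝ) ^ ν * Real.Gamma (ν + 1) :=
  mul_pos (Real.rpow_pos_of_pos two_pos ν) (gamma_add_one_pos hν)

theorem besselJ_eq {x : ℝ} (hx : 0 < x) :
    besselJ ν x = (2 ^ ν * Real.Gamma (ν + 1))⁻¹ * x ^ ν * besselEntire ν x := by
  have hΓ := (gamma_add_one_pos hν).ne'
  rw [besselJ, besselEntire, ← tsum_mul_left]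
  refine tsum_congr fun k => ?_
  have hΓk := (gamma_natCast_add_pos hν k).ne'
  have hpow : (x / 2) ^ (2 * (k : ℝ) + ν) = (x ^ 2) ^ k * x ^ ν / (4 ^ k * 2 ^ ν) := by
    rw [Real.rpow_add (half_pos hx), Real.rpow_mul (half_pos hx).le, Real.rpow_natCast,
      Real.rpow_two, Real.div_rpow hx.le two_pos.le, div_pow, div_pow, div_mul_div_comm]
    norm_num
  rw [hpow, besselCoeff]
  field_simp

theorem differentiableAt_besselJ {x : ℝ} (hx : 0 < x) : DifferentiableAt ℝ (besselJ ν) x :=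
  ((((Real.differentiableAt_rpow_const_of_ne ν hx.ne').const_mul _).mul
    (hasDerivAt_besselEntire hν x).differentiableAt)).congr_of_eventuallyEq <| by
      filter_upwards [lt_mem_nhds hx] with y hy using besselJ_eq hν hy

theorem hasDerivAt_normBessel {x : ℝ} (hx : 0 < x) :
    HasDerivAt (normBessel ν) (2 ^ ν * Real.Gamma (ν + 1) * x ^ (-ν) * dini ν x) x := by
  refine (((Real.hasDerivAt_rpow_const (p := 1 - ν) (Or.inl hx.ne')).const_mul
    (2 ^ ν * Real.Gamma (ν + 1))).mul (differentiableAt_besselJ hν hx).hasDerivAt).congr_deriv ?_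
  rw [dini, show 1 - ν - 1 = -ν by ring, show 1 - ν = -ν + 1 by ring, Real.rpow_add_one hx.ne']
  ring

theorem normBessel_eq {x : ℝ} (hx : 0 < x) : normBessel ν x = x * besselEntire ν x := by
  have hΓ := (gamma_add_one_pos hν).ne'
  rw [normBessel, besselJ_eq hν hx, Real.rpow_sub hx, Real.rpow_one]
  field_simp

theorem deriv_normBessel {x : ℝ} (hx : 0 < x) : deriv (normBessel ν) x = diniEntire ν x :=
  ((hasDerivAt_id_mul_besselEntire hν x).congr_of_eventuallyEq <| by
    filter_upwards [lt_mem_nhds hx] with y hy using normBessel_eq hν hy).deriv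

theorem dini_eq_zero_iff {x : ℝ} (hx : 0 < x) : dini ν x = 0 ↔ diniEntire ν x = 0 := by
  rw [← deriv_normBessel hν hx, (hasDerivAt_normBessel hν hx).deriv, mul_eq_zero,
    or_iff_right (mul_pos (two_rpow_mul_gamma_pos hν) (Real.rpow_pos_of_pos hx _)).ne']

theorem mul_sqrt_deriv_normBessel_le_iff {a b : ℝ} (ha : 0 < a) (hb : 0 < b) :
    |a - b| * √(deriv (normBessel ν) a * deriv (normBessel ν) b) ≤
        |normBessel ν a - normBessel ν b| ↔
      |a - b| * √((a * b) ^ (-ν) * dini ν a * dini ν b) ≤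
        |a ^ (1 - ν) * besselJ ν a - b ^ (1 - ν) * besselJ ν b| := by
  have hK := two_rpow_mul_gamma_pos hν
  rw [(hasDerivAt_normBessel hν ha).deriv, (hasDerivAt_normBessel hν hb).deriv, normBessel,
    normBessel]
  set K := 2 ^ ν * Real.Gamma (ν + 1)
  have hsq : K * a ^ (-ν) * dini ν a * (K * b ^ (-ν) * dini ν b) =
      K ^ 2 * ((a * b) ^ (-ν) * dini ν a * dini ν b) := by
    rw [Real.mul_rpow ha.le hb.le]
    ring
  rw [hsq, Real.sqrt_mul (sq_nonneg K), Real.sqrt_sq hK.le, mul_assoc K, mul_assoc K, ← mul_sub,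
    abs_mul, abs_of_pos hK, mul_left_comm, mul_le_mul_iff_right₀ hK]

end Bessel

/-! ### The sign of the Dini function -/

theorem pos_on_Ioo_of_eventually_pos {f : ℝ → ℝ} {a b : ℝ} (hf : ContinuousOn f (Set.Ioo a b))
    (ha : ∀ᶠ x in 𝓝[>] a, 0 < f x) (hne : ∀ x ∈ Set.Ioo a b, f x ≠ 0) :
    ∀ x ∈ Set.Ioo a b, 0 < f x := by
  intro x hx
  by_contra! hle
  obtain ⟨y, hy, hay, hyx⟩ := (ha.and (Ioo_mem_nhdsGT hx.1)).exists
  obtain ⟨z, hz, hz0⟩ := isPreconnected_Ioo.intermediate_value hx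
    (⟨hay, hyx.trans hx.2⟩ : y ∈ Set.Ioo a b) hf ⟨hle, hy.le⟩
  exact hne z hz hz0

theorem isLeast_sInf_zeros {f : ℝ → ℝ} {a : ℝ} (hf : Continuous f)
    (ha : ∀ᶠ x in 𝓝[>] a, f x ≠ 0) (hex : ∃ x, a < x ∧ f x = 0) :
    IsLeast {x | a < x ∧ f x = 0} (sInf {x | a < x ∧ f x = 0}) := by
  have hbdd : BddBelow {x | a < x ∧ f x = 0} := ⟨a, fun x hx => hx.1.le⟩
  obtain ⟨c, hac, hc⟩ := mem_nhdsGT_iff_exists_Ioo_subset.1 ha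
  have hlt : a < sInf {x | a < x ∧ f x = 0} :=
    hac.trans_le (le_csInf hex fun x hx => not_lt.1 fun hxc => hc ⟨hx.1, hxc⟩ hx.2)
  have hzero : f (sInf {x | a < x ∧ f x = 0}) = 0 :=
    (isClosed_eq hf continuous_const).closure_subset_iff.2 (fun x hx => hx.2)
      (csInf_mem_closure hex hbdd)
  exact ⟨⟨hlt, hzero⟩, fun x hx => csInf_le hbdd hx⟩

theorem eventually_neg_nhdsGT_of_deriv_ne_zero {f : ℝ → ℝ} {a b : ℝ} (hab : a < b)
    (hpos : ∀ x ∈ Set.Ioo a b, 0 < f x) (hb : f b = 0) (hd : deriv f b ≠ 0) :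
    ∀ᶠ x in 𝓝[>] b, f x < 0 := by
  rcases hd.lt_or_gt with hneg | hpos'
  · filter_upwards [(eventually_nhdsWithin_sign_eq_of_deriv_neg hneg hb).filter_mono
      nhdsWithin_le_nhds, self_mem_nhdsWithin] with x hx hbx
    rwa [sign_neg (sub_neg.2 (Set.mem_Ioi.1 hbx)), sign_eq_neg_one_iff] at hx
  · obtain ⟨x, hx, hxI⟩ := (((eventually_nhdsWithin_sign_eq_of_deriv_pos hpos' hb).filter_mono
      nhdsWithin_le_nhds).and (Ioo_mem_nhdsLT hab)).exists
    rw [sign_neg (sub_neg.2 hxI.2), sign_eq_neg_one_iff] at hx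
    exact absurd hx (hpos x hxI).not_gt

section Bessel

variable {ν : ℝ} (hν : -1 < ν)
include hν

theorem isLeast_diniZero_succ {n : ℕ} (h0 : 0 ≤ diniZero ν n)
    (hne : ∀ᶠ x in 𝓝[>] diniZero ν n, diniEntire ν x ≠ 0) :
    IsLeast {x | diniZero ν n < x ∧ diniEntire ν x = 0} (diniZero ν (n + 1)) := by
  have heq : {x | diniZero ν n < x ∧ dini ν x = 0} =
      {x | diniZero ν n < x ∧ diniEntire ν x = 0} :=
    Set.ext fun x => and_congr_right fun hx => dini_eq_zero_iff hν (h0.trans_lt hx)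
  rw [diniZero, heq]
  exact isLeast_sInf_zeros (continuous_diniEntire hν) hne (exists_diniEntire_eq_zero hν _)

theorem diniEntire_pos_on_Ioo_diniZero {n : ℕ} {s : ℝ} (h0 : 0 ≤ diniZero ν n)
    (hpos : ∀ᶠ x in 𝓝[>] diniZero ν n, 0 < s * diniEntire ν x) :
    ∀ x ∈ Set.Ioo (diniZero ν n) (diniZero ν (n + 1)), 0 < s * diniEntire ν x := by
  have hleast := isLeast_diniZero_succ hν h0 (hpos.mono fun x hx => right_ne_zero_of_mul hx.ne')
  obtain ⟨y, hy⟩ := hpos.exists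
  exact pos_on_Ioo_of_eventually_pos ((continuous_diniEntire hν).const_mul s).continuousOn hpos
    fun x hx => mul_ne_zero (left_ne_zero_of_mul hy.ne') fun hx0 =>
      (hleast.2 ⟨hx.1, hx0⟩).not_gt hx.2

/- The zeros of `diniEntire` are simple, so its sign alternates. -/
theorem diniZero_nonneg_and_eventually_pos (n : ℕ) :
    0 ≤ diniZero ν n ∧ ∀ᶠ x in 𝓝[>] diniZero ν n, 0 < (-1) ^ n * diniEntire ν x := by
  induction n with
  | zero =>
    have h0 : 0 < diniEntire ν 0 := by rw [diniEntire_zero hν]; exact one_pos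
    simpa [diniZero] using
      ((continuous_diniEntire hν).continuousAt.eventually_const_lt h0).filter_mono
        nhdsWithin_le_nhds
  | succ n ih =>
    obtain ⟨h0, hpos⟩ := ih
    have hsign : (-1 : ℝ) ^ n ≠ 0 := by simp
    obtain ⟨hlt, hzero⟩ :=
      (isLeast_diniZero_succ hν h0 (hpos.mono fun x hx => right_ne_zero_of_mul hx.ne')).1
    have hsimple := deriv_diniEntire_ne_zero hν (h0.trans_lt hlt) hzero
    have hneg := eventually_neg_nhdsGT_of_deriv_ne_zero hlt
      (diniEntire_pos_on_Ioo_diniZero hν h0 hpos) (by rw [hzero, mul_zero])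
      (by rw [deriv_const_mul_field]; exact mul_ne_zero hsign hsimple)
    exact ⟨(h0.trans_lt hlt).le, hneg.mono fun x hx => by rw [pow_succ]; linarith⟩

theorem pos_of_mem_deltaInterval {k : ℕ} {x : ℝ} (hx : x ∈ deltaInterval ν k) : 0 < x :=
  (diniZero_nonneg_and_eventually_pos hν (2 * k)).1.trans_lt hx.1

theorem diniEntire_pos_of_mem_deltaInterval {k : ℕ} {x : ℝ} (hx : x ∈ deltaInterval ν k) :
    0 < diniEntire ν x := by
  obtain ⟨h0, hpos⟩ := diniZero_nonneg_and_eventually_pos hν (2 * k)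
  simpa using diniEntire_pos_on_Ioo_diniZero hν h0 hpos x hx

theorem logConcaveOn_deriv_normBessel (k : ℕ) :
    LogConcaveOn (deltaInterval ν k) (deriv (normBessel ν)) := by
  have hderiv : Set.EqOn (diniEntire ν) (deriv (normBessel ν)) (deltaInterval ν k) :=
    fun x hx => (deriv_normBessel hν (pos_of_mem_deltaInterval hν hx)).symm
  refine ⟨fun x hx => hderiv hx ▸ diniEntire_pos_of_mem_deltaInterval hν hx,
    (concaveOn_log_diniEntire hν (convex_Ioo _ _) fun x hx =>
      (diniEntire_pos_of_mem_deltaInterval hν hx).ne').congr fun x hx => ?_⟩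
  simp only [hderiv hx]

end Bessel

theorem theorem4 (ν : ℝ) (hν : -1 < ν) :
    (∀ x : ℝ, 0 < x →
      HasDerivAt (normBessel ν)
        ((2 : ℝ) ^ ν * Real.Gamma (ν + 1) * x ^ (-ν) * dini ν x) x) ∧
    (∀ k : ℕ, LogConcaveOn (deltaInterval ν k) (deriv (normBessel ν))) ∧
    (∀ k : ℕ, ∀ a ∈ deltaInterval ν k, ∀ b ∈ deltaInterval ν k,
      |a - b| * √(deriv (normBessel ν) a * deriv (normBessel ν) b)
        ≤ |normBessel ν a - normBessel ν b|) ∧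
    (∀ k : ℕ, ∀ a ∈ deltaInterval ν k, ∀ b ∈ deltaInterval ν k,
      |a - b| * √((a * b) ^ (-ν) * dini ν a * dini ν b)
        ≤ |a ^ (1 - ν) * besselJ ν a - b ^ (1 - ν) * besselJ ν b|) := by
  have hg (x : ℝ) (hx : 0 < x) := hasDerivAt_normBessel hν hx
  have hpos {k : ℕ} {x : ℝ} (hx : x ∈ deltaInterval ν k) := pos_of_mem_deltaInterval hν hx
  have hineq (k : ℕ) (a : ℝ) (ha : a ∈ deltaInterval ν k) (b : ℝ) (hb : b ∈ deltaInterval ν k) :=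
    abs_sub_mul_sqrt_le_of_logConcaveOn (logConcaveOn_deriv_normBessel hν k)
      (fun x hx => (hg x (hpos hx)).differentiableAt.hasDerivAt) ha hb
  exact ⟨hg, logConcaveOn_deriv_normBessel hν, hineq, fun k a ha b hb =>
    (mul_sqrt_deriv_normBessel_le_iff hν (hpos ha) (hpos hb)).1 (hineq k a ha b hb)⟩
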